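/- For $p>1$, $m\in\mathbb R$ and $v>0$, let $\mathcal M_p(m,v)$ be the set of all cumulative distribution functions $F$ on $\mathbb R$ with finite $p$-th moment such that $$\int_0^1 F^{-1}(t)\,\mathrm dt=m,\qquad \int_0^1|F^{-1}(t)-m|^p\,\mathrm dt\le v^p,$$ where $F^{-1}(t)=\inf\{x\in\mathbb R: F(x)\ge t\}$. For a set $\mathcal M$ of distribution functions put, for $x\in\mathbb R$, $$F^-_{\mathcal M}(x)=\inf_{F\in\mathcal M}F(x),\qquad F^+_{\mathcal M}(x)=\sup_{F\in\mathcal M}F(x),\qquad \widehat F^-_{\mathcal M}(x)=\inf_{F\in\mathcal M}F(x-),$$ where $F(x-)$ is the left limit of $F$ at $x$. We say that $F^+_{\mathcal M}$ (resp. $\widehat F^-_{\mathcal M}$) is attainable if for every $x\in\mathbb R$ there is $F\in\mathcal M$ with $F(x)=F^+_{\mathcal M}(x)$ (resp. $F(x-)=\widehat F^-_{\mathcal M}(x)$). For an increasing (in the non-strict sense) function $g:(0,1)\to\mathbb R$ put $g_+^{-1}(x)=\inf\{t\in(0,1): g(t)>x\}$, with the convention $\inf\emptyset=1$. **Proposition.**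 Let $p>1$, $m\in\mathbb R$ and $v>0$, and define, for $\alpha\in(0,1)$, $$l(\alpha)=m+v\alpha\left(\alpha^p(1-\alpha)+(1-\alpha)^p\alpha\right)^{-1/p},\qquad u(\alpha)=m-v(1-\alpha)\left(\alpha^p(1-\alpha)+(1-\alpha)^p\alpha\right)^{-1/p}.$$ Then $l$ and $u$ are increasing on $(0,1)$, and for all $x\in\mathbb R$ $$F^-_{\mathcal M_p(m,v)}(x)=l_+^{-1}(x),\qquad F^+_{\mathcal M_p(m,v)}(x)=u_+^{-1}(x).$$ In particular, for $p=2$ and all $x\in\mathbb R$, $$F^-_{\mathcal M_2(m,v)}(x)=\frac{(x-m)^2}{v^2+(x-m)^2}\,\mathbf 1_{\{x\ge m\}},\qquad F^+_{\mathcal M_2(m,v)}(x)=\frac{v^2}{v^2+(m-x)^2}\,\mathbf 1_{\{x\le m\}}+\mathbf 1_{\{x>m\}}.$$ Moreover, for every $p>1$, both $\widehat F^-_{\mathcal M_p(m,v)}$ and $F^+_{\mathcal M_p(m,v)}$ are continuous on $\mathbb R$ and attainable. -/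

import Mathlib

open MeasureTheory Set Filter Topology

namespace RobustQuantile

noncomputable section

/-- A monotone right-continuous function `F : ℝ → ℝ` is a cumulative distribution function if it
tends to `0` at `-∞` and to `1` at `+∞`. -/
def IsCDF (F : StieltjesFunction ℝ) : Prop :=
  Tendsto F atBot (𝓝 0) ∧ Tendsto F atTop (𝓝 1)

/-- The left quantile `F⁻¹(t) = inf {x : F(x) ≥ t}`; for a cdf and `t ∈ (0,1)` this is the infimum
of a nonempty set that is bounded below. -/
def leftQuantile (F : StieltjesFunction ℝ) (t : ℝ) : ℝ :=
  sInf {x : ℝ | t ≤ F x}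

/-- The set of all cdfs on `ℝ` with a finite `p`-th moment; `F.measure` is the
Lebesgue-Stieltjes measure `dF`. -/
def finiteMomentCDFs (p : ℝ) : Set (StieltjesFunction ℝ) :=
  {F | IsCDF F ∧ Integrable (fun x : ℝ => |x| ^ p) F.measure}

/-- The moment uncertainty set `M_p(m, v)`: mean `m`, and `p`-th central absolute moment at
most `v ^ p`. -/
def momentSet (p m v : ℝ) : Set (StieltjesFunction ℝ) :=
  {F | F ∈ finiteMomentCDFs p ∧ (∫ t in (0 : ℝ)..1, leftQuantile F t) = m ∧
    (∫ t in (0 : ℝ)..1, |leftQuantile F t - m| ^ p) ≤ v ^ p}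

/-- `F_M⁻(x) = inf_{F ∈ M} F(x)`. -/
def lowerExtremal (M : Set (StieltjesFunction ℝ)) (x : ℝ) : ℝ :=
  sInf ((fun F : StieltjesFunction ℝ => F x) '' M)

/-- `F_M⁺(x) = sup_{F ∈ M} F(x)`. -/
def upperExtremal (M : Set (StieltjesFunction ℝ)) (x : ℝ) : ℝ :=
  sSup ((fun F : StieltjesFunction ℝ => F x) '' M)

/-- The version of `F_M⁻` with left limits, `inf_{F ∈ M} F(x-)`. -/
def lowerExtremalLeft (M : Set (StieltjesFunction ℝ)) (x : ℝ) : ℝ :=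
  sInf ((fun F : StieltjesFunction ℝ => Function.leftLim F x) '' M)

/-- For each `x` some `F ∈ M` attains the supremum `F_M⁺(x)`. -/
def UpperAttainable (M : Set (StieltjesFunction ℝ)) : Prop :=
  ∀ x : ℝ, ∃ F ∈ M, F x = upperExtremal M x

/-- For each `x` some `F ∈ M` attains the infimum `inf_{F ∈ M} F(x-)`. -/
def LowerLeftAttainable (M : Set (StieltjesFunction ℝ)) : Prop :=
  ∀ x : ℝ, ∃ F ∈ M, Function.leftLim F x = lowerExtremalLeft M x

open scoped Classical in
/-- `g₊⁻¹(x) = inf {t ∈ (0,1) : g(t) > x}` with `inf ∅ = 1`; only the values of `g` on `(0,1)`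
matter. -/
def rightInverse (g : ℝ → ℝ) (x : ℝ) : ℝ :=
  if {t : ℝ | t ∈ Ioo (0 : ℝ) 1 ∧ x < g t}.Nonempty then
    sInf {t : ℝ | t ∈ Ioo (0 : ℝ) 1 ∧ x < g t}
  else 1

/-- `l(α) = m + v α (α^p (1-α) + (1-α)^p α)^(-1/p)`. -/
def lFun (p m v α : ℝ) : ℝ :=
  m + v * α * (α ^ p * (1 - α) + (1 - α) ^ p * α) ^ (-1 / p)

/-- `u(α) = m - v (1-α) (α^p (1-α) + (1-α)^p α)^(-1/p)`. -/
def uFun (p m v α : ℝ) : ℝ :=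
  m - v * (1 - α) * (α ^ p * (1 - α) + (1 - α) ^ p * α) ^ (-1 / p)

end

end RobustQuantile

/-! A centred variable that is at least `d ≥ 0` on an event of probability `s` must average at least
`d` there and at most `-s d / (1 - s)` on the complement. Jensen on the two pieces shows that its
absolute `p`-th moment is at least `d ^ p * φ(s)`, with `φ = twoPointMoment p`
(`rpow_mul_twoPointMoment_le`), and a two-point law gives equality. So moment at most `v ^ p` means
`d ≤ D(s)`, where `D = atomDist p v` is strictly decreasing from `(0,1)` onto `(0,∞)`.

The functions of the theorem are `u(α) = m - D(α)` and `l(α) = m + D(1 - α)`. The events `X ≤ x` and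
`X ≥ x` therefore give `F x ≤ u₊⁻¹(x)` and `l₊⁻¹(x) ≤ F(x-)`. The law with masses `α`, `1 - α` at
`u(α)`, `l(α)` attains both bounds; the Dirac law at `m` serves for `x` on the other side of the
mean. Continuity holds because the right inverse of a strictly increasing function has no jumps. -/

namespace RobustQuantile

/-! ### The two-point moment function -/

/-- The normalized `p`-th moment of the centred two-point law whose atom of mass `s` is at `-1`. -/
noncomputable def twoPointMoment (p s : ℝ) : ℝ := s + s ^ p * (1 - s) ^ (1 - p)

lemma twoPointMoment_pos {p s : ℝ} (hs : s ∈ Ioo (0 : ℝ) 1) : 0 < twoPointMoment p s := by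
  have h1 := hs.1
  have h2 : 0 < 1 - s := by linarith [hs.2]
  unfold twoPointMoment
  positivity

lemma twoPointMoment_strictMonoOn {p : ℝ} (hp : 1 < p) :
    StrictMonoOn (twoPointMoment p) (Ioo 0 1) := by
  intro a ha b hb hab
  have hb' : 0 < 1 - b := by linarith [hb.2]
  have ha' : 0 < 1 - a := by linarith [ha.2]
  have h1 : a ^ p ≤ b ^ p := Real.rpow_le_rpow ha.1.le hab.le (by linarith)
  have h2 : (1 - a) ^ (1 - p) ≤ (1 - b) ^ (1 - p) :=
    Real.rpow_le_rpow_of_nonpos hb' (by linarith) (by linarith)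
  have h3 : a ^ p * (1 - a) ^ (1 - p) ≤ b ^ p * (1 - b) ^ (1 - p) :=
    mul_le_mul h1 h2 (by positivity) (Real.rpow_nonneg hb.1.le _)
  unfold twoPointMoment
  linarith

lemma twoPointMoment_continuousOn (p : ℝ) :
    ContinuousOn (twoPointMoment p) (Ioo 0 1) := by
  unfold twoPointMoment
  refine continuousOn_id.add (ContinuousOn.mul ?_ ?_)
  · exact continuousOn_id.rpow_const fun x hx => Or.inl hx.1.ne'
  · exact (continuousOn_const.sub continuousOn_id).rpow_const fun x hx =>
      Or.inl (sub_ne_zero.2 hx.2.ne')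

/-- Isolating the odds `s / (1 - s)` makes the limits `0` and `∞` at the ends of `(0,1)` visible. -/
lemma twoPointMoment_eq_mul {p s : ℝ} (hs : s ∈ Ioo (0 : ℝ) 1) :
    twoPointMoment p s = s * (1 + (s / (1 - s)) ^ (p - 1)) := by
  have h1 := hs.1
  have h2 : 0 < 1 - s := by linarith [hs.2]
  have e1 : s ^ p = s * s ^ (p - 1) := by
    rw [Real.rpow_sub_one h1.ne']; field_simp
  have e2 : (1 - s) ^ (1 - p) = ((1 - s) ^ (p - 1))⁻¹ := by
    rw [← Real.rpow_neg h2.le]; ring_nf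
  rw [twoPointMoment, e1, e2, Real.div_rpow h1.le h2.le]
  field_simp

lemma exists_twoPointMoment_eq {p : ℝ} (hp : 1 < p) {c : ℝ} (hc : 0 < c) :
    ∃ s ∈ Ioo (0 : ℝ) 1, twoPointMoment p s = c := by
  -- Here `r` is the odds at the right endpoint `b`; since `b ≥ 1/2`, the value there is at least
  -- `(1/2) * 2c`.
  obtain ⟨r, hr1, hr⟩ : ∃ r : ℝ, 1 ≤ r ∧ 2 * c ≤ r ^ (p - 1) :=
    ((eventually_ge_atTop 1).and ((tendsto_rpow_atTop (by linarith : 0 < p - 1)).eventually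
      (eventually_ge_atTop (2 * c)))).exists
  set b := r / (1 + r) with hb
  have hr0 : 0 < 1 + r := by linarith
  have hb2 : 1 / 2 ≤ b := by rw [hb, div_le_div_iff₀ (by norm_num) hr0]; linarith
  have hb1 : b < 1 := by rw [hb, div_lt_one hr0]; linarith
  have hbI : b ∈ Ioo (0 : ℝ) 1 := ⟨by linarith, hb1⟩
  have hbr : b / (1 - b) = r := by
    have : 1 - b = 1 / (1 + r) := by rw [hb]; field_simp; ring
    rw [this, hb]; field_simp
  have hbc : c ≤ twoPointMoment p b := by
    rw [twoPointMoment_eq_mul hbI, hbr]; nlinarith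
  -- With `a ≤ 1/2` the odds are at most `1`, so the value at `a` is at most `2a ≤ c`.
  set a := min (1 / 2) (c / 2) with ha
  have ha2 : a ≤ 1 / 2 := min_le_left _ _
  have ha0 : 0 < a := by rw [ha]; positivity
  have haI : a ∈ Ioo (0 : ℝ) 1 := ⟨ha0, by linarith⟩
  have hac : twoPointMoment p a ≤ c := by
    have h1 : (a / (1 - a)) ^ (p - 1) ≤ 1 :=
      Real.rpow_le_one (div_nonneg ha0.le (by linarith))
        ((div_le_one (by linarith)).2 (by linarith)) (by linarith)
    rw [twoPointMoment_eq_mul haI]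
    have := min_le_right (1 / 2) (c / 2)
    nlinarith
  have hsub : Icc a b ⊆ Ioo (0 : ℝ) 1 := fun x hx => ⟨ha0.trans_le hx.1, hx.2.trans_lt hb1⟩
  obtain ⟨s, hs, h⟩ := intermediate_value_Icc (ha2.trans hb2)
    ((twoPointMoment_continuousOn p).mono hsub) ⟨hac, hbc⟩
  exact ⟨s, hsub hs, h⟩

/-! ### Atom distances and the functions `l`, `u` -/

/-- The distance from the mean to the atom of mass `s`. -/
noncomputable def atomDist (p v s : ℝ) : ℝ := v * twoPointMoment p s ^ (-1 / p)

lemma uFun_eq {p m v α : ℝ} (hp : 1 < p) (hα : α ∈ Ioo (0 : ℝ) 1) :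
    uFun p m v α = m - atomDist p v α := by
  have h1 := hα.1
  have h2 : 0 < 1 - α := by linarith [hα.2]
  have hp0 : p ≠ 0 := by linarith
  have e : α ^ p * (1 - α) + (1 - α) ^ p * α = (1 - α) ^ p * twoPointMoment p α := by
    have : (1 - α) ^ p * (1 - α) ^ (1 - p) = 1 - α := by
      rw [← Real.rpow_add h2]; simp
    rw [twoPointMoment]
    linear_combination (-α ^ p) * this
  rw [uFun, e, Real.mul_rpow (by positivity) (twoPointMoment_pos hα).le, ← Real.rpow_mul h2.le,
    mul_div_cancel₀ _ hp0, Real.rpow_neg_one, atomDist]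
  field_simp

/-- The bracket in `l` and `u` is symmetric under `α ↦ 1 - α`, so this is the formula for `u`,
reflected. -/
lemma lFun_eq {p m v α : ℝ} (hp : 1 < p) (hα : α ∈ Ioo (0 : ℝ) 1) :
    lFun p m v α = m + atomDist p v (1 - α) := by
  have h := uFun_eq (m := m) (v := v) hp
    (α := 1 - α) ⟨by linarith [hα.2], by linarith [hα.1]⟩
  have e : (1 - α) ^ p * (1 - (1 - α)) + (1 - (1 - α)) ^ p * (1 - α)
      = α ^ p * (1 - α) + (1 - α) ^ p * α := by
    rw [sub_sub_cancel]; ring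
  rw [uFun, e, sub_sub_cancel] at h
  rw [lFun]
  linarith

lemma atomDist_pos {p v s : ℝ} (hv : 0 < v) (hs : s ∈ Ioo (0 : ℝ) 1) : 0 < atomDist p v s :=
  mul_pos hv (Real.rpow_pos_of_pos (twoPointMoment_pos hs) _)

lemma atomDist_strictAntiOn {p v : ℝ} (hp : 1 < p) (hv : 0 < v) :
    StrictAntiOn (atomDist p v) (Ioo 0 1) := by
  intro a ha b hb hab
  refine mul_lt_mul_of_pos_left ?_ hv
  exact Real.rpow_lt_rpow_of_neg (twoPointMoment_pos ha)
    (twoPointMoment_strictMonoOn hp ha hb hab)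
    (div_neg_of_neg_of_pos (by norm_num) (by linarith))

lemma atomDist_rpow_mul {p v s : ℝ} (hp : 1 < p) (hv : 0 < v) (hs : s ∈ Ioo (0 : ℝ) 1) :
    atomDist p v s ^ p * twoPointMoment p s = v ^ p := by
  have h := twoPointMoment_pos (p := p) hs
  rw [atomDist, Real.mul_rpow hv.le (by positivity), ← Real.rpow_mul h.le,
    div_mul_cancel₀ _ (by linarith), Real.rpow_neg_one, mul_assoc, inv_mul_cancel₀ h.ne', mul_one]

/-- The moment bound is required only for `d ≥ 0`, so later applications need not ask on which side
of the mean `x` lies. -/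
lemma le_atomDist {p v s d : ℝ} (hp : 1 < p) (hv : 0 < v) (hs : s ∈ Ioo (0 : ℝ) 1)
    (h : 0 ≤ d → d ^ p * twoPointMoment p s ≤ v ^ p) : d ≤ atomDist p v s := by
  rcases lt_or_ge d 0 with hd | hd
  · exact hd.le.trans (atomDist_pos hv hs).le
  · have := h hd
    rw [← atomDist_rpow_mul hp hv hs] at this
    exact (Real.rpow_le_rpow_iff hd (atomDist_pos hv hs).le (by linarith)).1
      (le_of_mul_le_mul_right this (twoPointMoment_pos hs))

lemma exists_atomDist_eq {p v d : ℝ} (hp : 1 < p) (hv : 0 < v) (hd : 0 < d) :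
    ∃ s ∈ Ioo (0 : ℝ) 1, atomDist p v s = d := by
  obtain ⟨s, hs, h⟩ := exists_twoPointMoment_eq hp
    (Real.rpow_pos_of_pos (div_pos hv hd) p)
  refine ⟨s, hs, ?_⟩
  rw [atomDist, h, ← Real.rpow_mul (by positivity), mul_div_cancel₀ _ (by linarith),
    Real.rpow_neg_one]
  field_simp

lemma one_sub_mem_Ioo {α : ℝ} (hα : α ∈ Ioo (0 : ℝ) 1) : 1 - α ∈ Ioo (0 : ℝ) 1 :=
  ⟨by linarith [hα.2], by linarith [hα.1]⟩

/-- This balance is what gives the extremal two-point law mean `m`. -/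
lemma mul_atomDist_one_sub {p v α : ℝ} (hp : 1 < p) (hα : α ∈ Ioo (0 : ℝ) 1) :
    (1 - α) * atomDist p v (1 - α) = α * atomDist p v α := by
  have h1 := lFun_eq (m := 0) (v := v) hp hα
  have h2 := uFun_eq (m := 0) (v := v) hp hα
  rw [lFun] at h1
  rw [uFun] at h2
  linear_combination (α - 1) * h1 - α * h2

lemma lFun_strictMonoOn {p m v : ℝ} (hp : 1 < p) (hv : 0 < v) :
    StrictMonoOn (lFun p m v) (Ioo 0 1) := by
  intro a ha b hb hab
  rw [lFun_eq hp ha, lFun_eq hp hb]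
  have := atomDist_strictAntiOn hp hv (one_sub_mem_Ioo hb) (one_sub_mem_Ioo ha) (by linarith)
  linarith

lemma uFun_strictMonoOn {p m v : ℝ} (hp : 1 < p) (hv : 0 < v) :
    StrictMonoOn (uFun p m v) (Ioo 0 1) := by
  intro a ha b hb hab
  rw [uFun_eq hp ha, uFun_eq hp hb]
  have := atomDist_strictAntiOn hp hv ha hb hab
  linarith

lemma lt_lFun {p m v α : ℝ} (hp : 1 < p) (hv : 0 < v) (hα : α ∈ Ioo (0 : ℝ) 1) :
    m < lFun p m v α := by
  rw [lFun_eq hp hα]; linarith [atomDist_pos (p := p) hv (one_sub_mem_Ioo hα)]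

lemma uFun_lt {p m v α : ℝ} (hp : 1 < p) (hv : 0 < v) (hα : α ∈ Ioo (0 : ℝ) 1) :
    uFun p m v α < m := by
  rw [uFun_eq hp hα]; linarith [atomDist_pos (p := p) hv hα]

lemma exists_lFun_eq {p m v x : ℝ} (hp : 1 < p) (hv : 0 < v) (hx : m < x) :
    ∃ α ∈ Ioo (0 : ℝ) 1, lFun p m v α = x := by
  obtain ⟨s, hs, h⟩ := exists_atomDist_eq hp hv (sub_pos.2 hx)
  refine ⟨1 - s, one_sub_mem_Ioo hs, ?_⟩
  rw [lFun_eq hp (one_sub_mem_Ioo hs), sub_sub_cancel, h]; ring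

lemma exists_uFun_eq {p m v x : ℝ} (hp : 1 < p) (hv : 0 < v) (hx : x < m) :
    ∃ α ∈ Ioo (0 : ℝ) 1, uFun p m v α = x := by
  obtain ⟨s, hs, h⟩ := exists_atomDist_eq hp hv (sub_pos.2 hx)
  exact ⟨s, hs, by rw [uFun_eq hp hs, h]; ring⟩

/-! ### Right inverses of strictly increasing functions -/

section RightInverse

variable {g : ℝ → ℝ} {x t : ℝ}

lemma rightInverse_nonneg (g : ℝ → ℝ) (x : ℝ) : 0 ≤ rightInverse g x := by
  unfold rightInverse
  split_ifs with h
  · exact le_csInf h fun t ht => ht.1.1.le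
  · exact zero_le_one

lemma rightInverse_le (ht : t ∈ Ioo (0 : ℝ) 1) (hx : x < g t) : rightInverse g x ≤ t := by
  unfold rightInverse
  rw [if_pos ⟨t, ht, hx⟩]
  exact csInf_le ⟨0, fun s hs => hs.1.1.le⟩ ⟨ht, hx⟩

lemma rightInverse_le_one (g : ℝ → ℝ) (x : ℝ) : rightInverse g x ≤ 1 := by
  by_cases h : {t : ℝ | t ∈ Ioo (0 : ℝ) 1 ∧ x < g t}.Nonempty
  · obtain ⟨t, ht, hx⟩ := h
    exact (rightInverse_le ht hx).trans ht.2.le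
  · rw [rightInverse, if_neg h]

lemma le_rightInverse {c : ℝ} (hc : c ≤ 1) (h : ∀ t ∈ Ioo (0 : ℝ) 1, x < g t → c ≤ t) :
    c ≤ rightInverse g x := by
  unfold rightInverse
  split_ifs with hne
  · exact le_csInf hne fun t ht => h t ht.1 ht.2
  · exact hc

lemma le_rightInverse_of_le (hg : StrictMonoOn g (Ioo 0 1)) (ht : t ∈ Ioo (0 : ℝ) 1)
    (hx : g t ≤ x) : t ≤ rightInverse g x :=
  le_rightInverse ht.2.le fun _ hs hxs => ((hg.lt_iff_lt ht hs).1 (hx.trans_lt hxs)).le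

lemma rightInverse_le_of_le (hg : StrictMonoOn g (Ioo 0 1)) (ht : t ∈ Ioo (0 : ℝ) 1)
    (hx : x ≤ g t) : rightInverse g x ≤ t := by
  refine le_of_forall_gt_imp_ge_of_dense fun s hs => ?_
  rcases lt_or_ge s 1 with h1 | h1
  · have hsI : s ∈ Ioo (0 : ℝ) 1 := ⟨ht.1.trans hs, h1⟩
    exact rightInverse_le hsI (hx.trans_lt (hg ht hsI hs))
  · exact (rightInverse_le_one g x).trans h1

lemma rightInverse_apply (hg : StrictMonoOn g (Ioo 0 1)) (ht : t ∈ Ioo (0 : ℝ) 1) :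
    rightInverse g (g t) = t :=
  (rightInverse_le_of_le hg ht le_rfl).antisymm (le_rightInverse_of_le hg ht le_rfl)

lemma rightInverse_eq_zero (h : ∀ t ∈ Ioo (0 : ℝ) 1, x < g t) : rightInverse g x = 0 := by
  refine le_antisymm (le_of_forall_gt_imp_ge_of_dense fun s hs => ?_) (rightInverse_nonneg g x)
  rcases lt_or_ge s 1 with h1 | h1
  · exact rightInverse_le ⟨hs, h1⟩ (h s ⟨hs, h1⟩)
  · exact (rightInverse_le_one g x).trans h1

lemma rightInverse_eq_one (h : ∀ t ∈ Ioo (0 : ℝ) 1, g t ≤ x) : rightInverse g x = 1 :=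
  (rightInverse_le_one g x).antisymm
    (le_rightInverse le_rfl fun t ht hx => absurd hx (h t ht).not_gt)

/-- Jumps of the inverse would come from flat pieces of `g`, which strictness excludes; continuity
of `g` plays no role. -/
lemma continuous_rightInverse (hg : StrictMonoOn g (Ioo 0 1)) : Continuous (rightInverse g) := by
  refine continuous_iff_continuousAt.2 fun x => tendsto_order.2 ⟨fun a ha => ?_, fun a ha => ?_⟩
  · rcases lt_or_ge a 0 with h0 | h0
    · exact Eventually.of_forall fun y => h0.trans_le (rightInverse_nonneg g y)
    · obtain ⟨t, hat, htx⟩ := exists_between ha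
      -- The second point `s` gives the strict inequality `g t < g s ≤ x`, which survives for `y`
      -- near `x`.
      obtain ⟨s, hts, hsx⟩ := exists_between htx
      have hs1 := hsx.trans_le (rightInverse_le_one g x)
      have htI : t ∈ Ioo (0 : ℝ) 1 := ⟨h0.trans_lt hat, hts.trans hs1⟩
      have hsI : s ∈ Ioo (0 : ℝ) 1 := ⟨htI.1.trans hts, hs1⟩
      have hgs : g s ≤ x := not_lt.1 fun h => (rightInverse_le hsI h).not_gt hsx
      filter_upwards [lt_mem_nhds ((hg htI hsI hts).trans_le hgs)] with y hy
      exact hat.trans_le (le_rightInverse_of_le hg htI hy.le)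
  · rcases lt_or_ge 1 a with h1 | h1
    · exact Eventually.of_forall fun y => (rightInverse_le_one g y).trans_lt h1
    · obtain ⟨t, hxt, hta⟩ := exists_between ha
      have htI : t ∈ Ioo (0 : ℝ) 1 :=
        ⟨(rightInverse_nonneg g x).trans_lt hxt, hta.trans_le h1⟩
      have hgt : x < g t := not_le.1 fun h => (le_rightInverse_of_le hg htI h).not_gt hxt
      filter_upwards [gt_mem_nhds hgt] with y hy
      exact (rightInverse_le htI hy).trans_lt hta

end RightInverse

/-! ### From quantiles to laws -/

lemma leftQuantile_le_iff {F : StieltjesFunction ℝ} (hF : IsCDF F) {t : ℝ}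
    (ht : t ∈ Ioo (0 : ℝ) 1) (x : ℝ) : leftQuantile F t ≤ x ↔ t ≤ F x := by
  have hbdd : BddBelow {y : ℝ | t ≤ F y} := by
    obtain ⟨b, hb⟩ := (hF.1.eventually (gt_mem_nhds ht.1)).exists
    exact ⟨b, fun y hy => le_of_not_gt fun h => (hb.trans_le hy).not_ge (F.mono h.le)⟩
  have hne : {y : ℝ | t ≤ F y}.Nonempty := by
    obtain ⟨b, hb⟩ := (hF.2.eventually (lt_mem_nhds ht.2)).exists
    exact ⟨b, hb.le⟩
  refine ⟨fun h => ?_, fun h => csInf_le hbdd h⟩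
  -- Right continuity makes the infimum defining the quantile attained.
  have hc : Tendsto F (𝓝[>] x) (𝓝 (F x)) :=
    (F.right_continuous x).tendsto.mono_left (nhdsWithin_mono _ Ioi_subset_Ici_self)
  refine ge_of_tendsto hc ?_
  filter_upwards [self_mem_nhdsWithin] with y hy
  obtain ⟨z, hz, hzy⟩ := exists_lt_of_csInf_lt hne (lt_of_le_of_lt h hy)
  exact le_trans hz (F.mono hzy.le)

lemma IsCDF.mem_Icc {F : StieltjesFunction ℝ} (hF : IsCDF F) (x : ℝ) : F x ∈ Icc (0 : ℝ) 1 :=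
  ⟨F.mono.le_of_tendsto hF.1 x, F.mono.ge_of_tendsto hF.2 x⟩

lemma IsCDF.isProbabilityMeasure {F : StieltjesFunction ℝ} (hF : IsCDF F) :
    IsProbabilityMeasure F.measure :=
  F.isProbabilityMeasure hF.1 hF.2

lemma aemeasurable_leftQuantile {F : StieltjesFunction ℝ} (hF : IsCDF F) :
    AEMeasurable (leftQuantile F) (volume.restrict (Ioo (0 : ℝ) 1)) :=
  aemeasurable_restrict_of_monotoneOn measurableSet_Ioo fun _ hs _ ht hst =>
    (leftQuantile_le_iff hF hs _).2 (hst.trans ((leftQuantile_le_iff hF ht _).1 le_rfl))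

/-- The quantile transform: under the uniform law on `(0, 1)` the left quantile has law `dF`. -/
lemma map_leftQuantile {F : StieltjesFunction ℝ} (hF : IsCDF F) :
    (volume.restrict (Ioo (0 : ℝ) 1)).map (leftQuantile F) = F.measure := by
  have := hF.isProbabilityMeasure
  refine Measure.ext_of_Iic _ _ fun x => ?_
  have hm : NullMeasurableSet (leftQuantile F ⁻¹' Iic x) (volume.restrict (Ioo (0 : ℝ) 1)) :=
    (aemeasurable_leftQuantile hF).nullMeasurable measurableSet_Iic
  obtain ⟨h0, h1⟩ := hF.mem_Icc x
  have hset : leftQuantile F ⁻¹' Iic x ∩ Ioo 0 1 = Iic (F x) ∩ Ioo 0 1 := by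
    ext t
    simp only [mem_inter_iff, mem_preimage, mem_Iic]
    exact and_congr_left fun ht => leftQuantile_le_iff hF ht x
  rw [Measure.map_apply_of_aemeasurable (aemeasurable_leftQuantile hF) measurableSet_Iic,
    Measure.restrict_apply₀ hm, hset, F.measure_Iic hF.1, sub_zero]
  refine le_antisymm ?_ ?_
  · calc volume (Iic (F x) ∩ Ioo 0 1) ≤ volume (Icc 0 (F x)) :=
          measure_mono fun t ht => ⟨ht.2.1.le, ht.1⟩
      _ = ENNReal.ofReal (F x) := by simp
  · calc ENNReal.ofReal (F x) = volume (Ioo 0 (F x)) := by simp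
      _ ≤ volume (Iic (F x) ∩ Ioo 0 1) :=
          measure_mono fun t ht => ⟨ht.2.le, ht.1, ht.2.trans_le h1⟩

lemma integral_leftQuantile {F : StieltjesFunction ℝ} (hF : IsCDF F) {f : ℝ → ℝ}
    (hf : Continuous f) : ∫ t in (0 : ℝ)..1, f (leftQuantile F t) = ∫ x, f x ∂F.measure := by
  rw [intervalIntegral.integral_of_le zero_le_one, integral_Ioc_eq_integral_Ioo,
    ← map_leftQuantile hF, integral_map (aemeasurable_leftQuantile hF)
      hf.aestronglyMeasurable]

lemma memLp_id_of_integrable {μ : Measure ℝ} {p : ℝ} (hp : 1 < p)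
    (h : Integrable (fun x : ℝ => |x| ^ p) μ) : MemLp (fun x : ℝ => x) (ENNReal.ofReal p) μ := by
  have hp0 : 0 < p := by linarith
  refine (integrable_norm_rpow_iff aestronglyMeasurable_id (by simpa using hp0)
    ENNReal.ofReal_ne_top).1 ?_
  simpa [ENNReal.toReal_ofReal hp0.le] using h

/-- Laws with mean `m` and `p`-th central absolute moment at most `v ^ p`. -/
structure HasMoments (p m v : ℝ) (μ : Measure ℝ) : Prop where
  prob : IsProbabilityMeasure μ
  integrable_rpow : Integrable (fun x : ℝ => |x| ^ p) μ
  mean : ∫ x, x ∂μ = m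
  moment : ∫ x, |x - m| ^ p ∂μ ≤ v ^ p

lemma continuous_abs_sub_rpow {p : ℝ} (hp : 1 < p) (m : ℝ) :
    Continuous fun x : ℝ => |x - m| ^ p :=
  (by fun_prop : Continuous fun x : ℝ => |x - m|).rpow_const fun _ => Or.inr (by linarith)

/-- The quantile transform turns both constraints into integrals against `dF`; quantiles are not
needed afterwards. -/
lemma mem_momentSet_iff {p m v : ℝ} (hp : 1 < p) {F : StieltjesFunction ℝ} :
    F ∈ momentSet p m v ↔ IsCDF F ∧ HasMoments p m v F.measure := by
  constructor
  · rintro ⟨⟨hF, hi⟩, h1, h2⟩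
    rw [integral_leftQuantile hF (continuous_abs_sub_rpow hp m)] at h2
    exact ⟨hF, hF.isProbabilityMeasure, hi,
      (integral_leftQuantile hF continuous_id).symm.trans h1, h2⟩
  · rintro ⟨hF, h⟩
    refine ⟨⟨hF, h.integrable_rpow⟩, ?_, ?_⟩
    · exact (integral_leftQuantile hF continuous_id).trans h.mean
    · exact (integral_leftQuantile hF (continuous_abs_sub_rpow hp m)).trans_le h.moment

lemma cdf_mem_momentSet {p m v : ℝ} (hp : 1 < p) {μ : Measure ℝ} (h : HasMoments p m v μ) :
    ProbabilityTheory.cdf μ ∈ momentSet p m v := by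
  have := h.prob
  refine (mem_momentSet_iff hp).2 ⟨⟨ProbabilityTheory.tendsto_cdf_atBot μ,
    ProbabilityTheory.tendsto_cdf_atTop μ⟩, ?_⟩
  rwa [ProbabilityTheory.measure_cdf]

lemma IsCDF.apply_eq {F : StieltjesFunction ℝ} (hF : IsCDF F) (x : ℝ) :
    F x = F.measure.real (Iic x) := by
  rw [measureReal_def, F.measure_Iic hF.1, sub_zero, ENNReal.toReal_ofReal (hF.mem_Icc x).1]

lemma IsCDF.leftLim_eq {F : StieltjesFunction ℝ} (hF : IsCDF F) (x : ℝ) :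
    Function.leftLim F x = F.measure.real (Iio x) := by
  rw [measureReal_def, F.measure_Iio hF.1, sub_zero, ENNReal.toReal_ofReal]
  exact (hF.mem_Icc (x - 1)).1.trans (F.mono.le_leftLim (by linarith))

lemma leftLim_cdf (μ : Measure ℝ) [IsProbabilityMeasure μ] (x : ℝ) :
    Function.leftLim (ProbabilityTheory.cdf μ) x = μ.real (Iio x) := by
  rw [IsCDF.leftLim_eq ⟨ProbabilityTheory.tendsto_cdf_atBot μ,
    ProbabilityTheory.tendsto_cdf_atTop μ⟩, ProbabilityTheory.measure_cdf]

/-! ### Sharp tail bounds from Jensen's inequality -/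

/-- Jensen's inequality on an event, in terms of a lower bound for the absolute first moment. -/
lemma rpow_mul_le_setIntegral {μ : Measure ℝ} [IsProbabilityMeasure μ] {p : ℝ} (hp : 1 < p)
    {f : ℝ → ℝ} (hf : Integrable f μ) (hfp : Integrable (fun x => |f x| ^ p) μ) {A : Set ℝ}
    {b d : ℝ} (hb : 0 < b) (hA : μ.real A = b) (hd : 0 ≤ d) (h : b * d ≤ ∫ x in A, |f x| ∂μ) :
    b * d ^ p ≤ ∫ x in A, |f x| ^ p ∂μ := by
  have h0 : μ A ≠ 0 := fun h0 => by simp [measureReal_def, h0] at hA; exact hb.ne hA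
  have hJ := (convexOn_rpow hp.le).map_set_average_le (μ := μ) (t := A) (f := fun x => |f x|)
    (continuousOn_id.rpow_const fun _ _ => Or.inr (by linarith)) isClosed_Ici h0
    (measure_ne_top _ _) (ae_of_all _ fun x => abs_nonneg (f x)) hf.abs.integrableOn
    hfp.integrableOn
  rw [setAverage_eq, setAverage_eq, hA, smul_eq_mul, smul_eq_mul] at hJ
  have h1 : d ≤ b⁻¹ * ∫ x in A, |f x| ∂μ := by
    rw [le_inv_mul_iff₀ hb]; exact h
  have h2 := (Real.rpow_le_rpow hd h1 (by linarith : (0 : ℝ) ≤ p)).trans hJ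
  rwa [le_inv_mul_iff₀ hb] at h2

/-- A centred variable that is at least `d` on an event of probability `s` has absolute `p`-th
moment at least that of the two-point law. -/
lemma rpow_mul_twoPointMoment_le {μ : Measure ℝ} [IsProbabilityMeasure μ] {p : ℝ} (hp : 1 < p)
    {f : ℝ → ℝ} (hf : Integrable f μ) (hfp : Integrable (fun x => |f x| ^ p) μ)
    (hf0 : ∫ x, f x ∂μ = 0) {A : Set ℝ} (hA : MeasurableSet A) {s d : ℝ} (hs : μ.real A = s)
    (hsI : s ∈ Ioo (0 : ℝ) 1) (hd : 0 ≤ d) (hAd : ∀ x ∈ A, d ≤ f x) :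
    d ^ p * twoPointMoment p s ≤ ∫ x, |f x| ^ p ∂μ := by
  have hs0 := hsI.1
  have hs1 : 0 < 1 - s := by linarith [hsI.2]
  have hsc : μ.real Aᶜ = 1 - s := by rw [probReal_compl_eq_one_sub hA, hs]
  have hS : s * d ≤ ∫ x in A, f x ∂μ := by
    have := setIntegral_mono_on (μ := μ) (f := fun _ => d)
      (integrableOn_const (measure_ne_top _ _)) hf.integrableOn hA hAd
    simpa [hs] using this
  have hSc : ∫ x in A, f x ∂μ = ∫ x in Aᶜ, -f x ∂μ := by
    rw [integral_neg, eq_neg_iff_add_eq_zero, integral_add_compl hA hf, hf0]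
  have e1 : s * d ≤ ∫ x in A, |f x| ∂μ :=
    hS.trans (integral_mono hf.integrableOn hf.abs.integrableOn fun x => le_abs_self _)
  -- The value `s * d / (1 - s)` is where an atom of mass `1 - s` balances mass `s` at distance `d`.
  have e2 : (1 - s) * (s * d / (1 - s)) ≤ ∫ x in Aᶜ, |f x| ∂μ := by
    rw [mul_div_cancel₀ _ hs1.ne']
    exact (hS.trans_eq hSc).trans
      (integral_mono hf.neg.integrableOn hf.abs.integrableOn fun x => neg_le_abs _)
  have j1 := rpow_mul_le_setIntegral hp hf hfp hs0 hs hd e1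
  have j2 := rpow_mul_le_setIntegral hp hf hfp hs1 hsc (by positivity) e2
  rw [← integral_add_compl hA hfp]
  refine le_trans (le_of_eq ?_) (add_le_add j1 j2)
  rw [Real.div_rpow (by positivity) hs1.le, Real.mul_rpow hs0.le hd, twoPointMoment,
    Real.rpow_sub hs1, Real.rpow_one]
  ring

lemma HasMoments.integrable {p m v : ℝ} (hp : 1 < p) {μ : Measure ℝ} (h : HasMoments p m v μ) :
    Integrable (fun x : ℝ => x) μ := by
  have := h.prob
  exact (memLp_id_of_integrable hp h.integrable_rpow).integrable (by simpa using hp.le)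

lemma HasMoments.integrable_sub {p m v : ℝ} (hp : 1 < p) {μ : Measure ℝ}
    (h : HasMoments p m v μ) : Integrable (fun x : ℝ => |x - m| ^ p) μ := by
  have := h.prob
  have hp0 : 0 < p := by linarith
  have := ((memLp_id_of_integrable hp h.integrable_rpow).sub (memLp_const m)).integrable_norm_rpow
    (by simpa using hp0) ENNReal.ofReal_ne_top
  simpa [ENNReal.toReal_ofReal hp0.le] using this

lemma HasMoments.uFun_le {p m v : ℝ} (hp : 1 < p) (hv : 0 < v) {μ : Measure ℝ}
    (h : HasMoments p m v μ) {x : ℝ} (hs : μ.real (Iic x) ∈ Ioo (0 : ℝ) 1) :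
    uFun p m v (μ.real (Iic x)) ≤ x := by
  have := h.prob
  have hi := h.integrable hp
  have hd : m - x ≤ atomDist p v (μ.real (Iic x)) := by
    refine le_atomDist hp hv hs fun hd => ?_
    refine (rpow_mul_twoPointMoment_le (μ := μ) hp (f := fun y => m - y)
      ((integrable_const m).sub hi) ?_ ?_ measurableSet_Iic rfl hs hd ?_).trans ?_
    · simpa only [abs_sub_comm m] using h.integrable_sub hp
    · rw [integral_sub (integrable_const m) hi, h.mean]; simp
    · intro y hy
      have := mem_Iic.1 hy
      linarith
    · simpa only [abs_sub_comm m] using h.moment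
  rw [uFun_eq hp hs]
  linarith

/-- The event `X ≥ x` has probability `1 - F(x-)`, hence the left limit in the lower bound. -/
lemma HasMoments.le_lFun {p m v : ℝ} (hp : 1 < p) (hv : 0 < v) {μ : Measure ℝ}
    (h : HasMoments p m v μ) {x : ℝ} (hs : μ.real (Iio x) ∈ Ioo (0 : ℝ) 1) :
    x ≤ lFun p m v (μ.real (Iio x)) := by
  have := h.prob
  have hi := h.integrable hp
  have hd : x - m ≤ atomDist p v (1 - μ.real (Iio x)) := by
    refine le_atomDist hp hv (one_sub_mem_Ioo hs) fun hd => ?_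
    refine (rpow_mul_twoPointMoment_le (μ := μ) hp (f := fun y => y - m)
      (hi.sub (integrable_const m)) (h.integrable_sub hp) ?_ (A := Ici x) measurableSet_Ici ?_
      (one_sub_mem_Ioo hs) hd ?_).trans h.moment
    · rw [integral_sub hi (integrable_const m), h.mean]; simp
    · rw [← compl_Iio, probReal_compl_eq_one_sub measurableSet_Iio]
    · intro y hy
      have := mem_Ici.1 hy
      linarith
  rw [lFun_eq hp hs]
  linarith

/-- Settles the degenerate case `F x = 1`, outside the domain `(0,1)` of `u`; `le_mean` does the
same for `F(x-) = 0`. -/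
lemma HasMoments.mean_le {p m v : ℝ} (hp : 1 < p) {μ : Measure ℝ} (h : HasMoments p m v μ) {x : ℝ}
    (h1 : μ.real (Iic x) = 1) : m ≤ x := by
  have := h.prob
  have hae : ∀ᵐ y ∂μ, y ≤ x := by
    rw [measureReal_def, ENNReal.toReal_eq_one_iff] at h1
    exact (prob_compl_eq_zero_iff measurableSet_Iic).2 h1
  have := integral_mono_ae (h.integrable hp) (integrable_const x) hae
  simpa [h.mean] using this

lemma HasMoments.le_mean {p m v : ℝ} (hp : 1 < p) {μ : Measure ℝ} (h : HasMoments p m v μ) {x : ℝ}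
    (h0 : μ.real (Iio x) = 0) : x ≤ m := by
  have := h.prob
  have hae : ∀ᵐ y ∂μ, x ≤ y := by
    have h0' : μ (Iio x) = 0 := (measureReal_eq_zero_iff).1 h0
    filter_upwards [measure_eq_zero_iff_ae_notMem.1 h0'] with y hy
    simpa using hy
  have := integral_mono_ae (integrable_const x) (h.integrable hp) hae
  simpa [h.mean] using this

lemma HasMoments.measureReal_Iic_le {p m v : ℝ} (hp : 1 < p) (hv : 0 < v) {μ : Measure ℝ}
    (h : HasMoments p m v μ) (x : ℝ) : μ.real (Iic x) ≤ rightInverse (uFun p m v) x := by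
  have := h.prob
  rcases eq_or_lt_of_le (measureReal_nonneg (μ := μ) (s := Iic x)) with h0 | h0
  · exact h0.symm.trans_le (rightInverse_nonneg _ _)
  rcases eq_or_lt_of_le (measureReal_le_one (μ := μ) (s := Iic x)) with h1 | h1
  · rw [h1, rightInverse_eq_one fun t ht => (uFun_lt hp hv ht).le.trans (h.mean_le hp h1)]
  · exact le_rightInverse_of_le (uFun_strictMonoOn hp hv) ⟨h0, h1⟩ (h.uFun_le hp hv ⟨h0, h1⟩)

lemma HasMoments.le_measureReal_Iio {p m v : ℝ} (hp : 1 < p) (hv : 0 < v) {μ : Measure ℝ}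
    (h : HasMoments p m v μ) (x : ℝ) : rightInverse (lFun p m v) x ≤ μ.real (Iio x) := by
  have := h.prob
  rcases eq_or_lt_of_le (measureReal_nonneg (μ := μ) (s := Iio x)) with h0 | h0
  · rw [← h0, rightInverse_eq_zero fun t ht => (h.le_mean hp h0.symm).trans_lt (lt_lFun hp hv ht)]
  rcases eq_or_lt_of_le (measureReal_le_one (μ := μ) (s := Iio x)) with h1 | h1
  · exact (rightInverse_le_one _ _).trans_eq h1.symm
  · exact rightInverse_le_of_le (lFun_strictMonoOn hp hv) ⟨h0, h1⟩ (h.le_lFun hp hv ⟨h0, h1⟩)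

/-! ### Extremal two-point laws -/

/-- The law with mass `α` at `a` and mass `1 - α` at `b`. -/
noncomputable def twoPoint (α a b : ℝ) : Measure ℝ :=
  ENNReal.ofReal α • Measure.dirac a + ENNReal.ofReal (1 - α) • Measure.dirac b

section TwoPoint

variable {α a b : ℝ}

lemma isProbabilityMeasure_twoPoint (hα : α ∈ Icc (0 : ℝ) 1) :
    IsProbabilityMeasure (twoPoint α a b) := by
  refine ⟨?_⟩
  have h : 0 ≤ 1 - α := sub_nonneg.2 hα.2
  simp [twoPoint, ← ENNReal.ofReal_add hα.1 h]

lemma integrable_twoPoint (f : ℝ → ℝ) : Integrable f (twoPoint α a b) :=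
  ((integrable_dirac (by simp)).smul_measure ENNReal.ofReal_ne_top).add_measure
    ((integrable_dirac (by simp)).smul_measure ENNReal.ofReal_ne_top)

lemma integral_twoPoint (hα : α ∈ Icc (0 : ℝ) 1) (f : ℝ → ℝ) :
    ∫ x, f x ∂twoPoint α a b = α * f a + (1 - α) * f b := by
  rw [twoPoint, integral_add_measure
    ((integrable_dirac (by simp)).smul_measure ENNReal.ofReal_ne_top)
    ((integrable_dirac (by simp)).smul_measure ENNReal.ofReal_ne_top)]
  simp [ENNReal.toReal_ofReal hα.1, ENNReal.toReal_ofReal (sub_nonneg.2 hα.2)]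

lemma twoPoint_real_of_mem (hα : α ∈ Icc (0 : ℝ) 1) {A : Set ℝ} (ha : a ∈ A) (hb : b ∉ A) :
    (twoPoint α a b).real A = α := by
  simp [twoPoint, measureReal_def, ha, hb, ENNReal.toReal_ofReal hα.1]

lemma twoPoint_real_le (hα : α ∈ Icc (0 : ℝ) 1) {A : Set ℝ} (hb : b ∉ A) :
    (twoPoint α a b).real A ≤ α := by
  by_cases ha : a ∈ A
  · exact (twoPoint_real_of_mem hα ha hb).le
  · simpa [twoPoint, measureReal_def, ha, hb] using hα.1

end TwoPoint

/-- The moment constraint is met with equality, which is the equality case of the Jensen bound. -/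
lemma hasMoments_twoPoint {p m v α : ℝ} (hp : 1 < p) (hv : 0 < v) (hα : α ∈ Ioo (0 : ℝ) 1) :
    HasMoments p m v (twoPoint α (uFun p m v α) (lFun p m v α)) := by
  have hI := Ioo_subset_Icc_self hα
  have hd := mul_atomDist_one_sub (v := v) hp hα
  have h0 := hα.1
  have h1 : 0 < 1 - α := by linarith [hα.2]
  refine ⟨isProbabilityMeasure_twoPoint hI, integrable_twoPoint _, ?_, ?_⟩
  · rw [integral_twoPoint hI, uFun_eq hp hα, lFun_eq hp hα]
    linarith
  · have hpos := atomDist_pos (p := p) hv hα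
    have hpos' := atomDist_pos (p := p) hv (one_sub_mem_Ioo hα)
    have e : atomDist p v (1 - α) = α * atomDist p v α / (1 - α) := by
      rw [eq_div_iff h1.ne']; linarith
    rw [integral_twoPoint hI, uFun_eq hp hα, lFun_eq hp hα, add_sub_cancel_left,
      sub_sub_cancel_left, abs_neg, abs_of_pos hpos, abs_of_pos hpos', e,
      Real.div_rpow (by positivity) h1.le, Real.mul_rpow h0.le hpos.le,
      ← atomDist_rpow_mul hp hv hα, twoPointMoment, Real.rpow_sub h1, Real.rpow_one]
    exact le_of_eq (by ring)

lemma hasMoments_dirac {p m v : ℝ} (hp : 1 < p) (hv : 0 < v) :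
    HasMoments p m v (Measure.dirac m) := by
  refine ⟨inferInstance, integrable_dirac (by simp), by simp, ?_⟩
  rw [integral_dirac, sub_self, abs_zero, Real.zero_rpow (by linarith)]
  positivity

/-! ### The extremal distribution functions -/

section Extremal

variable {p m v : ℝ}

lemma apply_le_of_mem_momentSet (hp : 1 < p) (hv : 0 < v) {F : StieltjesFunction ℝ}
    (hF : F ∈ momentSet p m v) (x : ℝ) : F x ≤ rightInverse (uFun p m v) x := by
  obtain ⟨hc, hm⟩ := (mem_momentSet_iff hp).1 hF
  exact (hc.apply_eq x).trans_le (hm.measureReal_Iic_le hp hv x)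

lemma le_leftLim_of_mem_momentSet (hp : 1 < p) (hv : 0 < v) {F : StieltjesFunction ℝ}
    (hF : F ∈ momentSet p m v) (x : ℝ) :
    rightInverse (lFun p m v) x ≤ Function.leftLim F x := by
  obtain ⟨hc, hm⟩ := (mem_momentSet_iff hp).1 hF
  exact (hm.le_measureReal_Iio hp hv x).trans_eq (hc.leftLim_eq x).symm

lemma exists_apply_eq (hp : 1 < p) (hv : 0 < v) (x : ℝ) :
    ∃ F ∈ momentSet p m v, F x = rightInverse (uFun p m v) x := by
  rcases le_or_gt m x with hx | hx
  · refine ⟨_, cdf_mem_momentSet hp (hasMoments_dirac hp hv), ?_⟩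
    rw [ProbabilityTheory.cdf_eq_real,
      rightInverse_eq_one fun t ht => (uFun_lt hp hv ht).le.trans hx]
    simp [measureReal_def, hx]
  · obtain ⟨α, hα, rfl⟩ := exists_uFun_eq hp hv hx
    have hm := hasMoments_twoPoint (m := m) hp hv hα
    have := hm.prob
    refine ⟨_, cdf_mem_momentSet hp hm, ?_⟩
    rw [ProbabilityTheory.cdf_eq_real, rightInverse_apply (uFun_strictMonoOn hp hv) hα]
    refine twoPoint_real_of_mem (Ioo_subset_Icc_self hα) self_mem_Iic ?_
    exact notMem_Iic.2 (hx.trans (lt_lFun hp hv hα))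

lemma exists_leftLim_eq (hp : 1 < p) (hv : 0 < v) (x : ℝ) :
    ∃ F ∈ momentSet p m v, Function.leftLim F x = rightInverse (lFun p m v) x := by
  rcases le_or_gt x m with hx | hx
  · refine ⟨_, cdf_mem_momentSet hp (hasMoments_dirac hp hv), ?_⟩
    rw [leftLim_cdf, rightInverse_eq_zero fun t ht => hx.trans_lt (lt_lFun hp hv ht)]
    simp [measureReal_def, hx]
  · obtain ⟨α, hα, rfl⟩ := exists_lFun_eq hp hv hx
    have hm := hasMoments_twoPoint (m := m) hp hv hα
    have := hm.prob
    refine ⟨_, cdf_mem_momentSet hp hm, ?_⟩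
    rw [leftLim_cdf, rightInverse_apply (lFun_strictMonoOn hp hv) hα]
    exact twoPoint_real_of_mem (Ioo_subset_Icc_self hα)
      ((uFun_lt hp hv hα).trans hx) (by simp)

lemma upperExtremal_momentSet (hp : 1 < p) (hv : 0 < v) (x : ℝ) :
    upperExtremal (momentSet p m v) x = rightInverse (uFun p m v) x := by
  obtain ⟨F, hF, h⟩ := exists_apply_eq (m := m) hp hv x
  refine IsGreatest.csSup_eq ⟨⟨F, hF, h⟩, ?_⟩
  rintro _ ⟨G, hG, rfl⟩
  exact apply_le_of_mem_momentSet hp hv hG x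

lemma lowerExtremalLeft_momentSet (hp : 1 < p) (hv : 0 < v) (x : ℝ) :
    lowerExtremalLeft (momentSet p m v) x = rightInverse (lFun p m v) x := by
  obtain ⟨F, hF, h⟩ := exists_leftLim_eq (m := m) hp hv x
  refine IsLeast.csInf_eq ⟨⟨F, hF, h⟩, ?_⟩
  rintro _ ⟨G, hG, rfl⟩
  exact le_leftLim_of_mem_momentSet hp hv hG x

lemma lowerExtremal_momentSet (hp : 1 < p) (hv : 0 < v) (x : ℝ) :
    lowerExtremal (momentSet p m v) x = rightInverse (lFun p m v) x := by
  have hlb : ∀ F ∈ momentSet p m v, rightInverse (lFun p m v) x ≤ F x := fun F hF =>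
    (le_leftLim_of_mem_momentSet hp hv hF x).trans (F.mono.leftLim_le le_rfl)
  have hbdd : BddBelow ((fun F : StieltjesFunction ℝ => F x) '' momentSet p m v) :=
    ⟨_, forall_mem_image.2 hlb⟩
  refine le_antisymm (le_rightInverse ?_ fun t ht hx => ?_) (le_csInf ?_ (forall_mem_image.2 hlb))
  · have hF := cdf_mem_momentSet hp (hasMoments_dirac (m := m) hp hv)
    exact (csInf_le hbdd (mem_image_of_mem _ hF)).trans (ProbabilityTheory.cdf_le_one _ _)
  -- The law with upper atom exactly at `x` would give `F x = 1`. Any `t` with `l(t) > x` moves that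
  -- atom beyond `x`, so `F x ≤ t`.
  · have hm := hasMoments_twoPoint (m := m) hp hv ht
    have := hm.prob
    refine (csInf_le hbdd (mem_image_of_mem _ (cdf_mem_momentSet hp hm))).trans ?_
    simp only [ProbabilityTheory.cdf_eq_real]
    exact twoPoint_real_le (Ioo_subset_Icc_self ht) (notMem_Iic.2 hx)
  · exact ⟨_, mem_image_of_mem _ (cdf_mem_momentSet hp (hasMoments_dirac hp hv))⟩

end Extremal

/-! ### Closed forms for `p = 2` -/

lemma atomDist_two {v y : ℝ} (hv : 0 < v) (hy : 0 < y) :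
    atomDist 2 v (v ^ 2 / (v ^ 2 + y ^ 2)) = y := by
  have hs : v ^ 2 / (v ^ 2 + y ^ 2) ∈ Ioo (0 : ℝ) 1 :=
    ⟨by positivity, (div_lt_one (by positivity)).2 (by nlinarith)⟩
  -- For `p = 2` the two-point moment is just the odds `s / (1 - s)`, here `v ^ 2 / y ^ 2`.
  have e : twoPointMoment 2 (v ^ 2 / (v ^ 2 + y ^ 2)) = (v / y) ^ (2 : ℝ) := by
    have e1 : 1 - v ^ 2 / (v ^ 2 + y ^ 2) = y ^ 2 / (v ^ 2 + y ^ 2) := by field_simp; ring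
    rw [twoPointMoment_eq_mul hs, e1]
    norm_num
    field_simp
    ring
  rw [atomDist, e, ← Real.rpow_mul (by positivity), mul_div_cancel₀ _ two_ne_zero,
    Real.rpow_neg_one]
  field_simp

lemma rightInverse_lFun_two {m v : ℝ} (hv : 0 < v) (x : ℝ) :
    rightInverse (lFun 2 m v) x = if m ≤ x then (x - m) ^ 2 / (v ^ 2 + (x - m) ^ 2) else 0 := by
  rcases le_or_gt x m with hx | hx
  · rw [rightInverse_eq_zero fun t ht => hx.trans_lt (lt_lFun one_lt_two hv ht)]
    split_ifs with h
    · simp [le_antisymm h hx]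
    · rfl
  · have hy : 0 < x - m := sub_pos.2 hx
    have hα : (x - m) ^ 2 / (v ^ 2 + (x - m) ^ 2) ∈ Ioo (0 : ℝ) 1 :=
      ⟨by positivity, (div_lt_one (by positivity)).2 (by nlinarith)⟩
    have e : 1 - (x - m) ^ 2 / (v ^ 2 + (x - m) ^ 2) = v ^ 2 / (v ^ 2 + (x - m) ^ 2) := by
      rw [eq_div_iff (by positivity), sub_mul, div_mul_cancel₀ _ (by positivity)]; ring
    have hl : lFun 2 m v ((x - m) ^ 2 / (v ^ 2 + (x - m) ^ 2)) = x := by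
      rw [lFun_eq one_lt_two hα, e, atomDist_two hv hy]; ring
    rw [if_pos hx.le]
    nth_rw 1 [← hl]
    exact rightInverse_apply (lFun_strictMonoOn one_lt_two hv) hα

lemma rightInverse_uFun_two {m v : ℝ} (hv : 0 < v) (x : ℝ) :
    rightInverse (uFun 2 m v) x = if x ≤ m then v ^ 2 / (v ^ 2 + (m - x) ^ 2) else 1 := by
  rcases le_or_gt m x with hx | hx
  · rw [rightInverse_eq_one fun t ht => (uFun_lt one_lt_two hv ht).le.trans hx]
    split_ifs with h
    · simp [le_antisymm h hx, hv.ne']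
    · rfl
  · have hy : 0 < m - x := sub_pos.2 hx
    have hα : v ^ 2 / (v ^ 2 + (m - x) ^ 2) ∈ Ioo (0 : ℝ) 1 :=
      ⟨by positivity, (div_lt_one (by positivity)).2 (by nlinarith)⟩
    have hu : uFun 2 m v (v ^ 2 / (v ^ 2 + (m - x) ^ 2)) = x := by
      rw [uFun_eq one_lt_two hα, atomDist_two hv hy]; ring
    rw [if_pos hx.le]
    nth_rw 1 [← hu]
    exact rightInverse_apply (uFun_strictMonoOn one_lt_two hv) hα

end RobustQuantile

theorem mainTheorem7 (m v : ℝ) (hv : 0 < v) :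
    (∀ p : ℝ, 1 < p →
      MonotoneOn (RobustQuantile.lFun p m v) (Set.Ioo 0 1) ∧
      MonotoneOn (RobustQuantile.uFun p m v) (Set.Ioo 0 1) ∧
      (∀ x : ℝ, RobustQuantile.lowerExtremal (RobustQuantile.momentSet p m v) x
        = RobustQuantile.rightInverse (RobustQuantile.lFun p m v) x) ∧
      (∀ x : ℝ, RobustQuantile.upperExtremal (RobustQuantile.momentSet p m v) x
        = RobustQuantile.rightInverse (RobustQuantile.uFun p m v) x) ∧
      Continuous (RobustQuantile.lowerExtremalLeft (RobustQuantile.momentSet p m v)) ∧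
      RobustQuantile.LowerLeftAttainable (RobustQuantile.momentSet p m v) ∧
      Continuous (RobustQuantile.upperExtremal (RobustQuantile.momentSet p m v)) ∧
      RobustQuantile.UpperAttainable (RobustQuantile.momentSet p m v)) ∧
    (∀ x : ℝ, RobustQuantile.lowerExtremal (RobustQuantile.momentSet 2 m v) x
      = if m ≤ x then (x - m) ^ 2 / (v ^ 2 + (x - m) ^ 2) else 0) ∧
    (∀ x : ℝ, RobustQuantile.upperExtremal (RobustQuantile.momentSet 2 m v) x
      = if x ≤ m then v ^ 2 / (v ^ 2 + (m - x) ^ 2) else 1) := by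
  refine ⟨fun p hp => ?_, fun x => ?_, fun x => ?_⟩
  · refine ⟨(RobustQuantile.lFun_strictMonoOn hp hv).monotoneOn,
      (RobustQuantile.uFun_strictMonoOn hp hv).monotoneOn,
      RobustQuantile.lowerExtremal_momentSet hp hv,
      RobustQuantile.upperExtremal_momentSet hp hv, ?_, fun x => ?_, ?_, fun x => ?_⟩
    · rw [funext (RobustQuantile.lowerExtremalLeft_momentSet hp hv)]
      exact RobustQuantile.continuous_rightInverse (RobustQuantile.lFun_strictMonoOn hp hv)
    · rw [RobustQuantile.lowerExtremalLeft_momentSet hp hv]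
      exact RobustQuantile.exists_leftLim_eq hp hv x
    · rw [funext (RobustQuantile.upperExtremal_momentSet hp hv)]
      exact RobustQuantile.continuous_rightInverse (RobustQuantile.uFun_strictMonoOn hp hv)
    · rw [RobustQuantile.upperExtremal_momentSet hp hv]
      exact RobustQuantile.exists_apply_eq hp hv x
  · rw [RobustQuantile.lowerExtremal_momentSet one_lt_two hv,
      RobustQuantile.rightInverse_lFun_two hv]
  · rw [RobustQuantile.upperExtremal_momentSet one_lt_two hv,
      RobustQuantile.rightInverse_uFun_two hv]
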